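/- Let $n=4f+1=x^2+4y^2$ be a prime, where $f,x,y$ are integers with $f$ even and $x=\pm1$. Let $\alpha$ be a generator of the multiplicative group of $\mathbb{Z}_n$, let $D_i=\{\alpha^{4j+i}:0\le j<f\}$ $(0\le i<4)$ be the cyclotomic classes of order $4$, and let $s_1,s_3,s_4,s_6$ be the binary sequences of length $n$ (functions $\mathbb{Z}_n\to\{0,1\}$) with support sets $D_0\cup D_1$, $D_0\cup D_3$, $D_1\cup D_2$, $D_2\cup D_3$, respectively. Let $e=(e(0),e(1),e(2))$ be a binary sequence with $e(0)+e(1)+e(2)\equiv0\pmod 2$, and let $$(a_0,a_1,a_2,a_3)\in\left\{\begin{array}{l}(s_6,s_3,s_4,s_1),(s_6,s_4,s_3,s_1),(s_4,s_6,s_3,s_1),(s_3,s_6,s_4,s_1),\\ (s_4,s_1,s_6,s_3),(s_6,s_4,s_1,s_3),(s_1,s_4,s_6,s_3),(s_4,s_6,s_1,s_3),\\ (s_3,s_1,s_6,s_4),(s_6,s_3,s_1,s_4),(s_1,s_3,s_6,s_4),(s_3,s_6,s_1,s_4),\\ (s_4,s_1,s_3,s_6),(s_3,s_1,s_4,s_6),(s_1,s_3,s_4,s_6),(s_1,s_4,s_3,s_6)\end{array}\right\}.$$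 Put $\lambda=\frac{n+1}{2}$ and define binary sequences $c,d$ of length $2n$ by $$c(2i)=a_0(i),\quad c(2i+1)=e(0)+a_1(i+\lambda),\quad d(2i)=e(1)+a_2(i),\quad d(2i+1)=e(2)+a_3(i+\lambda)\qquad(0\le i<n),$$ with values added modulo $2$ and arguments of the $a_j$ taken modulo $n$. Let $u$ be the quaternary sequence of length $2n$ given by $u(k)=\phi^{-1}(c(k),d(k))$, where $\phi:\mathbb{Z}_4\to\mathbb{Z}_2\times\mathbb{Z}_2$ is the Gray mapping $\phi(0)=(0,0)$, $\phi(1)=(0,1)$, $\phi(2)=(1,1)$, $\phi(3)=(1,0)$. Let $R_u(\tau)=\sum_{k=0}^{2n-1}(\sqrt{-1})^{\,u(k)-u(k+\tau)}$, with arguments of $u$ taken modulo $2n$. Then $u$ is optimal, i.e. $\max_{1\le\tau<2n}|R_u(\tau)|=2$; moreover $R_u(\tau)\in\{2,-2\}$ for every $1\le\tau<2n$. -/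

import Mathlib

namespace QuaternarySeq

/-- Cross-correlation `R_{s,t}(τ) = ∑_{0 ≤ i < N} ξ ^ (s(i) - t(i + τ))` of two sequences of
length `N` over `ℤ/H`, where `ξ = exp(2π√-1/H)`. Sequences are indexed by `ZMod N`, so that the
subscript `i + τ` is taken modulo `N`. -/
noncomputable def crossCorr {N H : ℕ} (s t : ZMod N → ZMod H) (τ : ℕ) : ℂ :=
  ∑ i ∈ Finset.range N,
    Complex.exp (2 * Real.pi * Complex.I / H) ^ (s (i : ZMod N) - t ((i : ZMod N) + (τ : ZMod N))).val

/-- Auto-correlation `R_s(τ)`. -/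
noncomputable def autoCorr {N H : ℕ} (s : ZMod N → ZMod H) (τ : ℕ) : ℂ :=
  crossCorr s s τ

/-- `R_max(s) = max {|R_s(τ)| : 1 ≤ τ < N}`, for sequences of length `N ≥ 2`. -/
noncomputable def maxAutoCorr {N H : ℕ} (s : ZMod N → ZMod H) : ℝ :=
  sSup {r : ℝ | ∃ τ : ℕ, 1 ≤ τ ∧ τ < N ∧ r = ‖autoCorr s τ‖}

/-- A quaternary sequence of even length is optimal if its maximum out-of-phase auto-correlation
magnitude is `2`. -/
def IsOptimal {N : ℕ} (u : ZMod N → ZMod 4) : Prop :=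
  Even N ∧ maxAutoCorr u = 2

/-- The left shift `L^g(a) = (a(g), a(g+1), …, a(g+n-1))`. -/
def shift {n : ℕ} {A : Type*} (g : ℕ) (a : ZMod n → A) : ZMod n → A :=
  fun i => a (i + (g : ZMod n))

/-- The interleaved sequence `I(a, b)` of length `2n`: `I(a, b)(2i) = a(i)` and
`I(a, b)(2i+1) = b(i)` for `0 ≤ i < n`. -/
def interleave {n : ℕ} {A : Type*} (a b : ZMod n → A) : ZMod (2 * n) → A :=
  fun k => if k.val % 2 = 0 then a ((k.val / 2 : ℕ) : ZMod n) else b ((k.val / 2 : ℕ) : ZMod n)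

/-- The Gray mapping `0 ↦ (0,0)`, `1 ↦ (0,1)`, `2 ↦ (1,1)`, `3 ↦ (1,0)`. -/
def gray : ZMod 4 ≃ ZMod 2 × ZMod 2 where
  toFun z := if z = 0 then (0, 0) else if z = 1 then (0, 1) else if z = 2 then (1, 1) else (1, 0)
  invFun p := if p = (0, 0) then 0 else if p = (0, 1) then 1 else if p = (1, 1) then 2 else 3
  left_inv := by decide
  right_inv := by decide

/-- The quaternary sequence of length `2n` built from four binary sequences of odd length `n`
and a binary triple `e`: with `lam = (n+1)/2`,
`c = I(a₀, e(0) + L^lam(a₁))`, `d = I(e(1) + a₂, e(2) + L^lam(a₃))`, and `u(k) = φ⁻¹(c(k), d(k))`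
for the Gray mapping `φ`. -/
def quaternary {n : ℕ} (a₀ a₁ a₂ a₃ : ZMod n → ZMod 2) (e : Fin 3 → ZMod 2) :
    ZMod (2 * n) → ZMod 4 :=
  let lam : ℕ := (n + 1) / 2
  let c : ZMod (2 * n) → ZMod 2 := interleave a₀ (fun i => e 0 + shift lam a₁ i)
  let d : ZMod (2 * n) → ZMod 2 :=
    interleave (fun i => e 1 + a₂ i) (fun i => e 2 + shift lam a₃ i)
  fun k => gray.symm (c k, d k)

/-- The cyclotomic class `D_i = {α^(4j+i) : 0 ≤ j < f}` of order `4` in `ℤ/n`, `n = 4f+1`,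
with respect to the generator `α` of the multiplicative group. -/
def cycClass {n : ℕ} (f : ℕ) (α : (ZMod n)ˣ) (i : ℕ) : Finset (ZMod n) :=
  (Finset.range f).image fun j => ((α ^ (4 * j + i) : (ZMod n)ˣ) : ZMod n)

/-- The binary sequence with support set `S`. -/
def seqOfSupport {n : ℕ} (S : Finset (ZMod n)) : ZMod n → ZMod 2 :=
  fun i => if i ∈ S then 1 else 0

/-- `s₁` has support `D₀ ∪ D₁`. -/
def s₁ {n : ℕ} (f : ℕ) (α : (ZMod n)ˣ) : ZMod n → ZMod 2 :=
  seqOfSupport (cycClass f α 0 ∪ cycClass f α 1)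

/-- `s₃` has support `D₀ ∪ D₃`. -/
def s₃ {n : ℕ} (f : ℕ) (α : (ZMod n)ˣ) : ZMod n → ZMod 2 :=
  seqOfSupport (cycClass f α 0 ∪ cycClass f α 3)

/-- `s₄` has support `D₁ ∪ D₂`. -/
def s₄ {n : ℕ} (f : ℕ) (α : (ZMod n)ˣ) : ZMod n → ZMod 2 :=
  seqOfSupport (cycClass f α 1 ∪ cycClass f α 2)

/-- `s₆` has support `D₂ ∪ D₃`. -/
def s₆ {n : ℕ} (f : ℕ) (α : (ZMod n)ˣ) : ZMod n → ZMod 2 :=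
  seqOfSupport (cycClass f α 2 ∪ cycClass f α 3)

/-- The sixteen admissible arrangements of four sequences `t₁, t₃, t₄, t₆`. -/
def arrangements {A : Type*} (t₁ t₃ t₄ t₆ : A) : Set (A × A × A × A) :=
  {(t₆, t₃, t₄, t₁), (t₆, t₄, t₃, t₁), (t₄, t₆, t₃, t₁), (t₃, t₆, t₄, t₁),
   (t₄, t₁, t₆, t₃), (t₆, t₄, t₁, t₃), (t₁, t₄, t₆, t₃), (t₄, t₆, t₁, t₃),
   (t₃, t₁, t₆, t₄), (t₆, t₃, t₁, t₄), (t₁, t₃, t₆, t₄), (t₃, t₆, t₁, t₄),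
   (t₄, t₁, t₃, t₆), (t₃, t₁, t₄, t₆), (t₁, t₃, t₄, t₆), (t₁, t₄, t₃, t₆)}

end QuaternarySeq

namespace QuaternarySeq

/-! Let `χ` be the quartic character with `χ α = I`, with real and imaginary parts `R`, `S`, and put
P = R + S, Q = R - S. The signs of the four sequences are δ ∓ P and δ ∓ Q, where δ is the indicator
of 0. As f is even, χ(-1) = 1, so all of them are even functions. Write C(g, h) for the correlation
of g and h.

Under the Gray map, and for even components, R_u at an even shift is half the sum of the four
autocorrelations; at an odd shift it is ±(C(a₀, a₁) + C(a₂, a₃)). For even shifts the linear terms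
cancel and 2(C(P, P) + C(Q, Q)) = 4(C(R, R) + C(S, S)) = -4 remains, because J(χ, χ⁻¹) = -1
(`correlation_re_add_im`). For odd shifts each pair joins a P-term to a Q-term, and the second pair
has the signs opposite to the first, leaving 2δ ± 2 C(P, Q).

At t ≠ 0, C(P, Q) = C(R, R) - C(S, S) is the real part of χ(t)² J(χ, χ), that is ± Re J(χ, χ). This
integer is odd and |J|² = n = 1 + (2y)², so uniqueness of the two-square representation makes it ±1
(`correlation_re_sub_im`). At t = 0, C(P, Q) vanishes and δ supplies the value 2. -/

/-- Periodic cross-correlation of integer-valued functions on a finite group. -/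
def correlation {G : Type*} [Fintype G] [AddCommGroup G] (g h : G → ℤ) (t : G) : ℤ :=
  ∑ x, g x * h (x + t)

/-! ### Correlations of even functions on a finite abelian group. -/

section Correlation

variable {G : Type*} [Fintype G] [AddCommGroup G]

/-- The reflection x ↦ -t - x exchanges the two arguments. This symmetry later removes every
imaginary part. -/
theorem correlation_symm {g h : G → ℤ} (hg : g.Even) (hh : h.Even) (t : G) :
    correlation g h t = correlation h g t := by
  unfold correlation
  rw [← (Equiv.subLeft (-t)).sum_comp]
  refine Finset.sum_congr rfl fun x _ => ?_
  have h1 : g (-t - x) = g (x + t) := by rw [← hg]; congr 1; abel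
  have h2 : h (-t - x + t) = h x := by rw [← hh]; congr 1; abel
  simp only [Equiv.subLeft_apply]
  rw [h1, h2, mul_comm]

theorem sum_mul_shift_shift (g h : G → ℤ) (a b : G) :
    ∑ x, g (x + a) * h (x + b) = correlation g h (b - a) := by
  unfold correlation
  refine Fintype.sum_equiv (Equiv.addRight a) _ _ fun x => ?_
  simp only [Equiv.coe_addRight]
  congr 2; abel

/-- Correlation of two functions of the form `δ₀ + a P` with `P` even. -/
theorem correlation_single_add [DecidableEq G] {P Q : G → ℤ} (hP : P.Even) (a b : ℤ) (t : G) :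
    correlation (fun x => Pi.single (M := fun _ => ℤ) 0 1 x + a * P x)
      (fun x => Pi.single (M := fun _ => ℤ) 0 1 x + b * Q x) t =
      Pi.single (M := fun _ => ℤ) 0 1 t + b * Q t + a * P t + a * b * correlation P Q t := by
  unfold correlation
  have hs : ∀ x : G, (x + t = 0) ↔ x = -t := fun x => by
    rw [add_eq_zero_iff_eq_neg]
  simp only [Pi.single_apply, hs, mul_add, add_mul, Finset.sum_add_distrib, ite_mul, mul_ite,
    one_mul, mul_one, zero_mul, mul_zero, Finset.sum_ite_eq', Finset.mem_univ, if_true, zero_add,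
    hP t]
  have : (∑ x, a * P x * (b * Q (x + t))) = a * b * ∑ x, P x * Q (x + t) := by
    rw [Finset.mul_sum]; exact Finset.sum_congr rfl fun x _ => by ring
  rw [this]
  have h0 : (if -t = 0 then (1 : ℤ) else 0) = if t = 0 then 1 else 0 := by
    simp
  rw [h0]; ring

end Correlation

/-! ### Gray map and interleaving: from quaternary to binary correlations. -/

/-- The sign `(-1)^a` of a bit. -/
def bitSign (a : ZMod 2) : ℤ := if a = 0 then 1 else -1

theorem bitSign_add : ∀ a b : ZMod 2, bitSign (a + b) = bitSign a * bitSign b := by decide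

theorem bitSign_mul_self : ∀ a : ZMod 2, bitSign a * bitSign a = 1 := by decide

theorem bitSign_eq (a : ZMod 2) : bitSign a = 1 ∨ bitSign a = -1 := by
  revert a; decide

theorem exp_two_pi_I_div_four :
    Complex.exp (2 * Real.pi * Complex.I / ((4 : ℕ) : ℂ)) = Complex.I := by
  refine Eq.trans ?_ Complex.exp_pi_div_two_mul_I; congr 1; push_cast; ring

/-- With A, B the signs of a, b, the Gray map satisfies I^φ⁻¹(a, b) = ((1 + I)A + (1 - I)B)/2;
multiplying by the conjugate for (a', b') gives the formula. -/
theorem I_pow_val_gray_sub (a b a' b' : ZMod 2) :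
    Complex.I ^ (gray.symm (a, b) - gray.symm (a', b')).val =
      (((bitSign a * bitSign a' + bitSign b * bitSign b' : ℤ) : ℂ) +
        ((bitSign a * bitSign b' - bitSign b * bitSign a' : ℤ) : ℂ) * Complex.I) / 2 := by
  have key : ∀ a b a' b' : ZMod 2,
      let v := (gray.symm (a, b) - gray.symm (a', b')).val
      let r := bitSign a * bitSign a' + bitSign b * bitSign b'
      let s := bitSign a * bitSign b' - bitSign b * bitSign a'
      (v = 0 ∧ r = 2 ∧ s = 0) ∨ (v = 1 ∧ r = 0 ∧ s = 2) ∨ (v = 2 ∧ r = -2 ∧ s = 0) ∨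
        (v = 3 ∧ r = 0 ∧ s = -2) := by decide
  rcases key a b a' b' with ⟨h1, h2, h3⟩ | ⟨h1, h2, h3⟩ | ⟨h1, h2, h3⟩ | ⟨h1, h2, h3⟩ <;>
    rw [h1, h2, h3] <;> simp [Complex.I_pow_three, neg_div]

section Interleave

variable {n : ℕ} {A : Type*}

theorem interleave_two_mul (a b : ZMod n → A) (m : ℕ) :
    interleave a b ((2 * m : ℕ) : ZMod (2 * n)) = a (m : ZMod n) := by
  unfold interleave
  rw [ZMod.val_natCast, Nat.mul_mod_mul_left, if_pos (by omega), Nat.mul_div_cancel_left _ two_pos,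
    ZMod.natCast_mod]

theorem interleave_two_mul_add_one (a b : ZMod n → A) (m : ℕ) :
    interleave a b ((2 * m + 1 : ℕ) : ZMod (2 * n)) = b (m : ZMod n) := by
  unfold interleave
  have h1 : (2 * m + 1) % (2 * n) % 2 = 1 := by
    rw [Nat.mod_mul_right_mod]; omega
  have h2 : (2 * m + 1) % (2 * n) / 2 = m % n := by
    rw [Nat.mod_mul_right_div_self]; congr 1; omega
  rw [ZMod.val_natCast, if_neg (by omega), h2, ZMod.natCast_mod]

end Interleave

theorem sum_range_two_mul {M : Type*} [AddCommMonoid M] (F : ℕ → M) (n : ℕ) :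
    ∑ k ∈ Finset.range (2 * n), F k = ∑ i ∈ Finset.range n, (F (2 * i) + F (2 * i + 1)) := by
  induction n with
  | zero => simp
  | succ n ih =>
    rw [Nat.mul_succ, Finset.sum_range_succ, Finset.sum_range_succ, ih, Finset.sum_range_succ,
      add_assoc]

theorem sum_range_natCast_zmod {M : Type*} [AddCommMonoid M] {n : ℕ} [NeZero n] (F : ZMod n → M) :
    ∑ i ∈ Finset.range n, F (i : ZMod n) = ∑ x, F x := by
  refine Finset.sum_bij' (fun i _ => (i : ZMod n)) (fun x _ => x.val) ?_ ?_ ?_ ?_ ?_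
  · simp
  · intro x _; simpa using ZMod.val_lt x
  · intro i hi; exact ZMod.val_cast_of_lt (Finset.mem_range.1 hi)
  · intro x _; simp
  · simp

section Quaternary

variable {n : ℕ} (a₀ a₁ a₂ a₃ : ZMod n → ZMod 2) (e : Fin 3 → ZMod 2)

theorem quaternary_two_mul (m : ℕ) :
    quaternary a₀ a₁ a₂ a₃ e ((2 * m : ℕ) : ZMod (2 * n)) = gray.symm (a₀ m, e 1 + a₂ m) := by
  simp only [quaternary, interleave_two_mul]

theorem quaternary_two_mul_add_one (m : ℕ) :
    quaternary a₀ a₁ a₂ a₃ e ((2 * m + 1 : ℕ) : ZMod (2 * n)) =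
      gray.symm (e 0 + a₁ (m + ((n + 1) / 2 : ℕ)), e 2 + a₃ (m + ((n + 1) / 2 : ℕ))) := by
  simp only [quaternary, interleave_two_mul_add_one, shift]

variable [NeZero n]

/-- For even component sequences the auto-correlation of `quaternary` at an even shift. -/
theorem autoCorr_quaternary_two_mul (h₀ : a₀.Even) (h₁ : a₁.Even) (h₂ : a₂.Even) (h₃ : a₃.Even)
    (t : ℕ) :
    autoCorr (quaternary a₀ a₁ a₂ a₃ e) (2 * t) =
      ((correlation (bitSign ∘ a₀) (bitSign ∘ a₀) t + correlation (bitSign ∘ a₁) (bitSign ∘ a₁) t +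
        correlation (bitSign ∘ a₂) (bitSign ∘ a₂) t + correlation (bitSign ∘ a₃) (bitSign ∘ a₃) t :
        ℤ) : ℂ) / 2 := by
  have hE : ∀ {a : ZMod n → ZMod 2}, a.Even → (bitSign ∘ a).Even := fun h x =>
    congrArg bitSign (h x)
  unfold autoCorr crossCorr
  rw [exp_two_pi_I_div_four, sum_range_two_mul]
  set l : ZMod n := (((n + 1) / 2 : ℕ) : ZMod n) with hl
  let F : ZMod n → ℂ := fun x =>
    Complex.I ^ (gray.symm (a₀ x, e 1 + a₂ x) - gray.symm (a₀ (x + t), e 1 + a₂ (x + t))).val +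
    Complex.I ^ (gray.symm (e 0 + a₁ (x + l), e 2 + a₃ (x + l)) -
      gray.symm (e 0 + a₁ (x + t + l), e 2 + a₃ (x + t + l))).val
  trans ∑ i ∈ Finset.range n, F (i : ZMod n)
  · refine Finset.sum_congr rfl fun i _ => ?_
    rw [← Nat.cast_add (2 * i) (2 * t), ← Nat.cast_add (2 * i + 1) (2 * t), ← mul_add,
      show 2 * i + 1 + 2 * t = 2 * (i + t) + 1 by ring,
      quaternary_two_mul, quaternary_two_mul, quaternary_two_mul_add_one,
      quaternary_two_mul_add_one, Nat.cast_add]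
  rw [sum_range_natCast_zmod F]
  have e1 := bitSign_mul_self (e 1)
  have e0 := bitSign_mul_self (e 0)
  have e2 := bitSign_mul_self (e 2)
  -- In the real part each sign of `e` is squared and disappears; the imaginary part is
  -- antisymmetric, so it sums to zero by `correlation_symm`.
  have hF : ∀ x, F x =
      (((bitSign (a₀ x) * bitSign (a₀ (x + t)) + bitSign (a₂ x) * bitSign (a₂ (x + t)) +
        bitSign (a₁ (x + l)) * bitSign (a₁ (x + (t + l))) +
        bitSign (a₃ (x + l)) * bitSign (a₃ (x + (t + l))) : ℤ) : ℂ) +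
       ((bitSign (e 1) * (bitSign (a₀ x) * bitSign (a₂ (x + t)) -
          bitSign (a₂ x) * bitSign (a₀ (x + t))) +
         bitSign (e 0) * bitSign (e 2) * (bitSign (a₁ (x + l)) * bitSign (a₃ (x + (t + l))) -
          bitSign (a₃ (x + l)) * bitSign (a₁ (x + (t + l)))) : ℤ) : ℂ) * Complex.I) / 2 := by
    intro x
    simp only [F, I_pow_val_gray_sub, bitSign_add, add_assoc]
    rw [← add_div, add_add_add_comm, ← add_mul, ← Int.cast_add, ← Int.cast_add]
    refine congrArg (· / 2) (congrArg₂ (· + ·) (congrArg Int.cast ?_)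
      (congrArg (· * Complex.I) (congrArg Int.cast ?_)))
    · linear_combination (bitSign (a₂ x) * bitSign (a₂ (x + t))) * e1 +
        bitSign (a₁ (x + l)) * bitSign (a₁ (x + (t + l))) * e0 +
        bitSign (a₃ (x + l)) * bitSign (a₃ (x + (t + l))) * e2
    · ring
  simp only [hF]
  rw [← Finset.sum_div, Finset.sum_add_distrib, ← Finset.sum_mul, ← Int.cast_sum, ← Int.cast_sum]
  simp only [Finset.sum_add_distrib, ← Finset.mul_sum, Finset.sum_sub_distrib]
  have c := fun a b : ZMod n → ZMod 2 =>
    sum_mul_shift_shift (bitSign ∘ a) (bitSign ∘ b) l (t + l)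
  have d := fun a b : ZMod n → ZMod 2 =>
    sum_mul_shift_shift (bitSign ∘ a) (bitSign ∘ b) 0 (t : ZMod n)
  simp only [Function.comp_apply, add_zero, sub_zero, add_sub_cancel_right] at c d
  simp only [c, d]
  rw [correlation_symm (hE h₂) (hE h₀), correlation_symm (hE h₃) (hE h₁)]
  push_cast
  ring

/-- For even component sequences the auto-correlation of `quaternary` at an odd shift. -/
theorem autoCorr_quaternary_two_mul_add_one (hn : Odd n) (h₀ : a₀.Even) (h₁ : a₁.Even)
    (h₂ : a₂.Even) (h₃ : a₃.Even) (he : e 0 + e 1 + e 2 = 0) (t : ℕ) :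
    autoCorr (quaternary a₀ a₁ a₂ a₃ e) (2 * t + 1) =
      ((bitSign (e 0) * (correlation (bitSign ∘ a₀) (bitSign ∘ a₁) (t + ((n + 1) / 2 : ℕ)) +
        correlation (bitSign ∘ a₂) (bitSign ∘ a₃) (t + ((n + 1) / 2 : ℕ))) : ℤ) : ℂ) := by
  have hE : ∀ {a : ZMod n → ZMod 2}, a.Even → (bitSign ∘ a).Even := fun h x =>
    congrArg bitSign (h x)
  have he' : bitSign (e 0) * bitSign (e 1) * bitSign (e 2) = 1 := by
    rw [← bitSign_add, ← bitSign_add, he]; rfl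
  unfold autoCorr crossCorr
  rw [exp_two_pi_I_div_four, sum_range_two_mul]
  set l : ZMod n := (((n + 1) / 2 : ℕ) : ZMod n) with hl
  -- Since 2λ = n + 1 ≡ 1, the relative shifts t + λ (even to odd positions) and t + 1 - λ (odd to
  -- even positions) coincide.
  have hll : l + l = 1 := by
    obtain ⟨m, rfl⟩ := hn
    rw [hl, ← Nat.cast_add, show (2 * m + 1 + 1) / 2 + (2 * m + 1 + 1) / 2 = (2 * m + 1) + 1 by omega,
      Nat.cast_add, ZMod.natCast_self, zero_add, Nat.cast_one]
  have hl1 : (t : ZMod n) + 1 - l = t + l := by rw [← hll]; abel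
  let F : ZMod n → ℂ := fun x =>
    Complex.I ^ (gray.symm (a₀ x, e 1 + a₂ x) -
      gray.symm (e 0 + a₁ (x + t + l), e 2 + a₃ (x + t + l))).val +
    Complex.I ^ (gray.symm (e 0 + a₁ (x + l), e 2 + a₃ (x + l)) -
      gray.symm (a₀ (x + t + 1), e 1 + a₂ (x + t + 1))).val
  trans ∑ i ∈ Finset.range n, F (i : ZMod n)
  · refine Finset.sum_congr rfl fun i _ => ?_
    rw [← Nat.cast_add (2 * i) (2 * t + 1), ← Nat.cast_add (2 * i + 1) (2 * t + 1),
      show 2 * i + 1 + (2 * t + 1) = 2 * (i + t + 1) by ring,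
      show 2 * i + (2 * t + 1) = 2 * (i + t) + 1 by ring,
      quaternary_two_mul, quaternary_two_mul, quaternary_two_mul_add_one,
      quaternary_two_mul_add_one, Nat.cast_add, Nat.cast_add, Nat.cast_add, Nat.cast_one]
  rw [sum_range_natCast_zmod F]
  have e1 := bitSign_mul_self (e 1)
  have e0 := bitSign_mul_self (e 0)
  have e2 := bitSign_mul_self (e 2)
  -- The parity condition on `e` gives both component pairs the same sign, so it factors out of the
  -- real part.
  have e12 : bitSign (e 1) * bitSign (e 2) = bitSign (e 0) := by
    linear_combination bitSign (e 0) * he' - bitSign (e 1) * bitSign (e 2) * e0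
  have e01 : bitSign (e 0) * bitSign (e 1) = bitSign (e 2) := by
    linear_combination bitSign (e 2) * he' - bitSign (e 0) * bitSign (e 1) * e2
  have hF : ∀ x, F x =
      (((bitSign (e 0) * (bitSign (a₀ x) * bitSign (a₁ (x + (t + l))) +
          bitSign (a₂ x) * bitSign (a₃ (x + (t + l))) +
          bitSign (a₁ (x + l)) * bitSign (a₀ (x + (t + 1))) +
          bitSign (a₃ (x + l)) * bitSign (a₂ (x + (t + 1)))) : ℤ) : ℂ) +
       ((bitSign (e 2) * (bitSign (a₀ x) * bitSign (a₃ (x + (t + l))) -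
          bitSign (a₂ x) * bitSign (a₁ (x + (t + l))) +
          bitSign (a₁ (x + l)) * bitSign (a₂ (x + (t + 1))) -
          bitSign (a₃ (x + l)) * bitSign (a₀ (x + (t + 1)))) : ℤ) : ℂ) * Complex.I) / 2 := by
    intro x
    simp only [F, I_pow_val_gray_sub, bitSign_add, add_assoc]
    rw [← add_div, add_add_add_comm, ← add_mul, ← Int.cast_add, ← Int.cast_add]
    refine congrArg (· / 2) (congrArg₂ (· + ·) (congrArg Int.cast ?_)
      (congrArg (· * Complex.I) (congrArg Int.cast ?_)))
    · linear_combination (bitSign (a₂ x) * bitSign (a₃ (x + (t + l))) +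
        bitSign (a₃ (x + l)) * bitSign (a₂ (x + (t + 1)))) * e12
    · linear_combination (- bitSign (a₂ x) * bitSign (a₁ (x + (t + l))) +
        bitSign (a₁ (x + l)) * bitSign (a₂ (x + (t + 1)))) * e01
  simp only [hF]
  rw [← Finset.sum_div, Finset.sum_add_distrib, ← Finset.sum_mul, ← Int.cast_sum, ← Int.cast_sum]
  simp only [← Finset.mul_sum, Finset.sum_add_distrib, Finset.sum_sub_distrib]
  have c := fun a b : ZMod n → ZMod 2 =>
    sum_mul_shift_shift (bitSign ∘ a) (bitSign ∘ b) l (t + 1)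
  have d := fun a b : ZMod n → ZMod 2 =>
    sum_mul_shift_shift (bitSign ∘ a) (bitSign ∘ b) 0 (t + l)
  simp only [Function.comp_apply, add_zero, sub_zero, hl1] at c d
  simp only [c, d]
  rw [correlation_symm (hE h₁) (hE h₀), correlation_symm (hE h₃) (hE h₂),
    correlation_symm (hE h₃) (hE h₀), correlation_symm (hE h₂) (hE h₁)]
  push_cast
  ring

end Quaternary

/-! ### Uniqueness of the representation as a sum of two squares. -/

/-- If `n = 1 + y²` is a prime with `y` even, it has no other representation as a sum of an odd
and an even square. -/
theorem eq_one_or_neg_one_of_sq_add_sq {n a b y : ℤ} (hn : Prime n) (hy : Even y) (hny : n = 1 + y ^ 2)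
    (hab : a ^ 2 + b ^ 2 = n) (ha : Odd a) : a = 1 ∨ a = -1 := by
  have main : ∀ b : ℤ, a ^ 2 + b ^ 2 = n → n ∣ a * y + b → a = 1 ∨ a = -1 := by
    rintro b hb ⟨k, hk⟩
    have hpos : 0 < n := by rw [hny]; positivity
    -- Brahmagupta's identity (ay + b)² + (a - by)² = (1 + y²)(a² + b²) = n² bounds k by 1 in
    -- absolute value. If k = 0 then b = -ay, whence a² = 1; if k = ±1 then a = by is even, contrary
    -- to `ha`.
    have h1 : (n * k) ^ 2 + (a - b * y) ^ 2 = n * n := by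
      rw [← hk]; linear_combination (1 + y ^ 2) * hb - n * hny
    have hk1 : k ^ 2 ≤ 1 := by
      have : (n * n) * k ^ 2 ≤ (n * n) * 1 := by nlinarith [sq_nonneg (a - b * y)]
      exact le_of_mul_le_mul_left this (by positivity)
    have h3 : a * a = 1 ∨ a - b * y = 0 := by
      rcases (show k = 0 ∨ k ^ 2 = 1 by
        by_cases h : k = 0
        · exact Or.inl h
        · right; have := sq_pos_of_ne_zero (a := k) h; omega) with h | h
      · left
        subst h
        have hb' : b = -(a * y) := by linarith
        have : n * (a * a - 1) = 0 := by
          rw [hb'] at hb; linear_combination hb + (a * a) * hny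
        rcases mul_eq_zero.1 this with h | h
        · exact absurd h hn.ne_zero
        · linarith
      · right
        have : (a - b * y) ^ 2 = 0 := by
          rw [mul_pow, h] at h1; linarith
        exact pow_eq_zero_iff two_ne_zero |>.1 this
    rcases h3 with h | h
    · exact mul_self_eq_one_iff.1 h
    · exfalso
      rw [show a = b * y by linarith] at ha
      exact (Int.not_even_iff_odd.2 ha) (hy.mul_left b)
  -- (ay)² - b² = a²(n - 1) - (n - a²) = n(a² - 1).
  have hd : n ∣ (a * y + b) * (a * y + -b) :=
    ⟨a ^ 2 - 1, by linear_combination (-a ^ 2) * hny - hab⟩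
  rcases hn.dvd_or_dvd hd with h | h
  · exact main b hab h
  · exact main (-b) (by rw [neg_sq]; exact hab) h

/-! ### The quartic character and its cyclotomic classes. -/

section MulChar

variable {F : Type*} [Field F] [Fintype F]

/-- Substituting x ↦ -t x turns x + t into t(1 - x). -/
theorem sum_mulChar_mul_shift {R : Type*} [CommRing R] (χ ψ : MulChar F R) {t : F} (ht : t ≠ 0) :
    ∑ x, χ x * ψ (x + t) = χ (-t) * ψ t * jacobiSum χ ψ := by
  rw [jacobiSum, Finset.mul_sum, ← Equiv.sum_comp (Equiv.mulLeft₀ (-t) (neg_ne_zero.2 ht))]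
  refine Finset.sum_congr rfl fun x _ => ?_
  rw [Equiv.mulLeft₀_apply, map_mul, show -t * x + t = t * (1 - x) by ring, map_mul]
  ring

end MulChar

section Quartic

variable {n f : ℕ} [Fact n.Prime]

theorem exists_quartic_mulChar (hnf : n = 4 * f + 1) (α : (ZMod n)ˣ)
    (hα : ∀ β : (ZMod n)ˣ, β ∈ Subgroup.zpowers α) :
    ∃ χ : MulChar (ZMod n) ℂ, χ α = Complex.I := by
  let ζ : ℂˣ := Units.mk0 Complex.I Complex.I_ne_zero
  have hζ : ζ ∈ rootsOfUnity (Fintype.card (ZMod n)ˣ) ℂ := by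
    rw [mem_rootsOfUnity, ZMod.card_units, Units.ext_iff, hnf]
    simp [ζ, pow_mul]
  exact ⟨MulChar.ofRootOfUnity hζ hα, MulChar.ofRootOfUnity_spec hζ hα⟩

theorem exists_pow_generator (hnf : n = 4 * f + 1) (α : (ZMod n)ˣ)
    (hα : ∀ β : (ZMod n)ˣ, β ∈ Subgroup.zpowers α) {x : ZMod n} (hx : x ≠ 0) :
    ∃ j < f, ∃ i < 4, x = ((α ^ (4 * j + i) : (ZMod n)ˣ) : ZMod n) := by
  have ho : orderOf α = 4 * f := by
    rw [orderOf_eq_card_of_forall_mem_zpowers hα, Nat.card_eq_fintype_card, ZMod.card_units]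
    omega
  have := hα (Units.mk0 x hx)
  rw [mem_zpowers_iff_mem_range_orderOf, Finset.mem_image] at this
  obtain ⟨k, hk, hk'⟩ := this
  rw [Finset.mem_range, ho] at hk
  refine ⟨k / 4, by omega, k % 4, by omega, ?_⟩
  rw [Nat.div_add_mod, hk', Units.val_mk0]

theorem I_pow_injOn {i j : ℕ} (hi : i < 4) (hj : j < 4) (h : Complex.I ^ i = Complex.I ^ j) :
    i = j := by
  have hI : IsPrimitiveRoot Complex.I 4 := Complex.isPrimitiveRoot_I
  exact hI.pow_inj hi hj h

/-- As χ(α^(4j+i)) = I^i, the four classes are the fibres of `χ` on the nonzero residues. -/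
theorem mem_cycClass_iff (hnf : n = 4 * f + 1) (α : (ZMod n)ˣ)
    (hα : ∀ β : (ZMod n)ˣ, β ∈ Subgroup.zpowers α) {χ : MulChar (ZMod n) ℂ} (hχ : χ α = Complex.I)
    {i : ℕ} (hi : i < 4) (x : ZMod n) : x ∈ cycClass f α i ↔ χ x = Complex.I ^ i := by
  have hp : ∀ j i : ℕ, χ ((α ^ (4 * j + i) : (ZMod n)ˣ) : ZMod n) = Complex.I ^ i := fun j i => by
    rw [Units.val_pow_eq_pow_val, map_pow, hχ, pow_add, pow_mul, Complex.I_pow_four, one_pow, one_mul]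
  simp only [cycClass, Finset.mem_image, Finset.mem_range]
  constructor
  · rintro ⟨j, -, rfl⟩
    exact hp j i
  · intro h
    have hx : x ≠ 0 := by
      rintro rfl
      rw [MulChar.map_zero] at h
      exact pow_ne_zero i Complex.I_ne_zero h.symm
    obtain ⟨j, hj, k, hk, rfl⟩ := exists_pow_generator hnf α hα hx
    rw [hp] at h
    exact ⟨j, hj, by rw [I_pow_injOn hk hi h]⟩

/-- The sign sequences of `s₁, s₃, s₄, s₆` are `δ - P`, `δ - Q`, `δ + Q`, `δ + P`, where `P = R + S`,
`Q = R - S` and `R`, `S` are the real and imaginary parts of a quartic character. -/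
theorem exists_sign_functions (hnf : n = 4 * f + 1) (α : (ZMod n)ˣ)
    (hα : ∀ β : (ZMod n)ˣ, β ∈ Subgroup.zpowers α) {χ : MulChar (ZMod n) ℂ}
    (hχ : χ α = Complex.I) :
    ∃ R S : ZMod n → ℤ, (∀ x, χ x = R x + S x * Complex.I) ∧
      (∀ x, R x ^ 2 + S x ^ 2 = if x = 0 then 0 else 1) ∧
      ∀ x, bitSign (s₁ f α x) = Pi.single (M := fun _ => ℤ) 0 1 x + (-1) * (R x + S x) ∧
        bitSign (s₃ f α x) = Pi.single (M := fun _ => ℤ) 0 1 x + (-1) * (R x - S x) ∧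
        bitSign (s₄ f α x) = Pi.single (M := fun _ => ℤ) 0 1 x + 1 * (R x - S x) ∧
        bitSign (s₆ f α x) = Pi.single (M := fun _ => ℤ) 0 1 x + 1 * (R x + S x) := by
  have key : ∀ x : ZMod n, ∃ r s : ℤ, χ x = r + s * Complex.I ∧
      (r ^ 2 + s ^ 2 = if x = 0 then 0 else 1) ∧
      bitSign (s₁ f α x) = Pi.single (M := fun _ => ℤ) 0 1 x + (-1) * (r + s) ∧
      bitSign (s₃ f α x) = Pi.single (M := fun _ => ℤ) 0 1 x + (-1) * (r - s) ∧
      bitSign (s₄ f α x) = Pi.single (M := fun _ => ℤ) 0 1 x + 1 * (r - s) ∧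
      bitSign (s₆ f α x) = Pi.single (M := fun _ => ℤ) 0 1 x + 1 * (r + s) := by
    intro x
    have hm : ∀ i < 4, (x ∈ cycClass f α i ↔ χ x = Complex.I ^ i) := fun i hi =>
      mem_cycClass_iff hnf α hα hχ hi x
    simp only [s₁, s₃, s₄, s₆, seqOfSupport, Finset.mem_union, hm 0 (by norm_num),
      hm 1 (by norm_num), hm 2 (by norm_num), hm 3 (by norm_num), Pi.single_apply]
    by_cases hx : x = 0
    · subst hx
      refine ⟨0, 0, ?_⟩
      have h0 : ∀ i, ¬ (0 : ℂ) = Complex.I ^ i := fun i => (pow_ne_zero i Complex.I_ne_zero).symm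
      simp only [MulChar.map_zero, h0, if_true]
      simp [bitSign]
    · have hχx : ∃ i < 4, χ x = Complex.I ^ i := by
        obtain ⟨j, hj, i, hi, rfl⟩ := exists_pow_generator hnf α hα hx
        exact ⟨i, hi, (hm i hi).1 (Finset.mem_image.2 ⟨j, Finset.mem_range.2 hj, rfl⟩)⟩
      obtain ⟨i, hi, h⟩ := hχx
      have hinj : ∀ j < 4, (Complex.I ^ i = Complex.I ^ j ↔ i = j) := fun j hj =>
        ⟨I_pow_injOn hi hj, fun h => by rw [h]⟩
      simp only [h, hinj 0 (by norm_num), hinj 1 (by norm_num), hinj 2 (by norm_num),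
        hinj 3 (by norm_num), hx, if_false]
      interval_cases i
      · exact ⟨1, 0, by simp, by simp [bitSign]⟩
      · exact ⟨0, 1, by simp, by simp [bitSign]⟩
      · exact ⟨-1, 0, by simp, by simp [bitSign]⟩
      · exact ⟨0, -1, by simp [Complex.I_pow_three], by simp [bitSign]⟩
  choose R S h using key
  exact ⟨R, S, fun x => (h x).1, fun x => (h x).2.1, fun x => (h x).2.2⟩

end Quartic

theorem intCast_add_mul_I_inj {a b c d : ℤ}
    (h : (a + b * Complex.I : ℂ) = c + d * Complex.I) : a = c ∧ b = d := by
  have h1 := congrArg Complex.re h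
  have h2 := congrArg Complex.im h
  simp at h1 h2
  exact ⟨by exact_mod_cast h1, by exact_mod_cast h2⟩

theorem star_mulChar_eq {n : ℕ} {χ : MulChar (ZMod n) ℂ} {R S : ZMod n → ℤ}
    (hRS : ∀ x, χ x = R x + S x * Complex.I) (x : ZMod n) :
    χ⁻¹ x = R x - S x * Complex.I := by
  rw [← MulChar.star_apply', hRS]
  simp [sub_eq_add_neg]

/-! ### Jacobi sums and the correlations of R and S. -/

section Quartic

variable {n f : ℕ} [Fact n.Prime]

/-- -1 = α^(2f), because α^(2f) is a square root of 1 different from 1; hence χ(-1) = I^(2f) =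
(-1)^f. -/
theorem quartic_neg_one (hnf : n = 4 * f + 1) (hf : Even f) (α : (ZMod n)ˣ)
    (hα : ∀ β : (ZMod n)ˣ, β ∈ Subgroup.zpowers α) {χ : MulChar (ZMod n) ℂ}
    (hχ : χ α = Complex.I) : χ (-1) = 1 := by
  have ho : orderOf α = 4 * f := by
    rw [orderOf_eq_card_of_forall_mem_zpowers hα, Nat.card_eq_fintype_card, ZMod.card_units]
    omega
  have hf0 : 0 < f := by
    rcases Nat.eq_zero_or_pos f with h | h
    · exact absurd (Fact.out : n.Prime) (by rw [hnf, h]; norm_num)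
    · exact h
  have hsq : (α : ZMod n) ^ (2 * f) * (α : ZMod n) ^ (2 * f) = 1 := by
    rw [← pow_add, show 2 * f + 2 * f = orderOf α by omega, ← Units.val_pow_eq_pow_val,
      pow_orderOf_eq_one, Units.val_one]
  rcases mul_self_eq_one_iff.1 hsq with h | h
  · exfalso
    rw [← Units.val_pow_eq_pow_val, Units.val_eq_one] at h
    have := Nat.le_of_dvd (by omega) (orderOf_dvd_of_pow_eq_one h)
    omega
  · rw [← h, map_pow, hχ, pow_mul, Complex.I_sq, hf.neg_one_pow]

variable {χ : MulChar (ZMod n) ℂ} {R S : ZMod n → ℤ}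

theorem even_of_mulChar_eq (h1 : χ (-1) = 1) (hRS : ∀ x, χ x = R x + S x * Complex.I) :
    R.Even ∧ S.Even := by
  have : ∀ x, R (-x) = R x ∧ S (-x) = S x := fun x => by
    apply intCast_add_mul_I_inj
    rw [← hRS, ← hRS, ← neg_one_mul, map_mul, h1, one_mul]
  exact ⟨fun x => (this x).1, fun x => (this x).2⟩

theorem correlation_add_sub_self (R S : ZMod n → ℤ) (t : ZMod n) :
    correlation (fun x => R x + S x) (fun x => R x + S x) t +
      correlation (fun x => R x - S x) (fun x => R x - S x) t =
      2 * (correlation R R t + correlation S S t) := by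
  simp only [correlation, ← Finset.sum_add_distrib, Finset.mul_sum]
  exact Finset.sum_congr rfl fun x _ => by ring

theorem correlation_add_sub (hR : R.Even) (hS : S.Even) (t : ZMod n) :
    correlation (fun x => R x + S x) (fun x => R x - S x) t =
      correlation R R t - correlation S S t := by
  have h := correlation_symm hR hS t
  have : correlation (fun x => R x + S x) (fun x => R x - S x) t =
      correlation R R t - correlation S S t + (correlation S R t - correlation R S t) := by
    simp only [correlation, ← Finset.sum_add_distrib, ← Finset.sum_sub_distrib]
    exact Finset.sum_congr rfl fun x _ => by ring
  rw [this, h]; ring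

theorem sum_mulChar_mul_mulChar (hRS : ∀ x, χ x = R x + S x * Complex.I) (t : ZMod n) :
    ∑ x, χ x * χ (x + t) = ((correlation R R t - correlation S S t : ℤ) : ℂ) +
      ((correlation R S t + correlation S R t : ℤ) : ℂ) * Complex.I := by
  simp only [correlation, ← Finset.sum_add_distrib, ← Finset.sum_sub_distrib, Int.cast_sum,
    Finset.sum_mul]
  refine Finset.sum_congr rfl fun x _ => ?_
  rw [hRS, hRS]
  push_cast
  linear_combination (S x * S (x + t) : ℂ) * Complex.I_mul_I

theorem sum_mulChar_mul_inv (hRS : ∀ x, χ x = R x + S x * Complex.I) (t : ZMod n) :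
    ∑ x, χ x * χ⁻¹ (x + t) = ((correlation R R t + correlation S S t : ℤ) : ℂ) +
      ((correlation S R t - correlation R S t : ℤ) : ℂ) * Complex.I := by
  simp only [correlation, ← Finset.sum_add_distrib, ← Finset.sum_sub_distrib, Int.cast_sum,
    Finset.sum_mul]
  refine Finset.sum_congr rfl fun x _ => ?_
  rw [hRS, star_mulChar_eq hRS]
  push_cast
  linear_combination (-S x * S (x + t) : ℂ) * Complex.I_mul_I

/-- The left side is the real part of Σ χ(x) χ⁻¹(x + t), which equals J(χ, χ⁻¹) = -χ(-1). -/
theorem correlation_re_add_im (hRS : ∀ x, χ x = R x + S x * Complex.I) (hχ : χ ≠ 1)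
    (h1 : χ (-1) = 1) {t : ZMod n} (ht : t ≠ 0) :
    correlation R R t + correlation S S t = -1 := by
  have h := sum_mulChar_mul_shift χ χ⁻¹ ht
  have hu : χ t * χ⁻¹ t = 1 := by
    rw [← MulChar.mul_apply, mul_inv_cancel, MulChar.one_apply ht.isUnit]
  rw [jacobiSum_nontrivial_inv hχ, ← neg_one_mul, map_mul, h1, one_mul, hu,
    sum_mulChar_mul_inv hRS] at h
  refine (intCast_add_mul_I_inj (d := 0) (h.trans ?_)).1
  simp

theorem jacobiSum_quartic (hRS : ∀ x, χ x = R x + S x * Complex.I) (h1 : χ (-1) = 1) :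
    jacobiSum χ χ = ((correlation R R 1 - correlation S S 1 : ℤ) : ℂ) +
      ((correlation R S 1 + correlation S R 1 : ℤ) : ℂ) * Complex.I := by
  rw [← sum_mulChar_mul_mulChar hRS, sum_mulChar_mul_shift χ χ one_ne_zero, h1, map_one, one_mul,
    one_mul]

/-- This is |J(χ, χ)|² = n in coordinates, valid because χ and χ² are both nontrivial. -/
theorem norm_jacobiSum_quartic (hRS : ∀ x, χ x = R x + S x * Complex.I) (hχ : χ ≠ 1)
    (hχ2 : χ * χ ≠ 1) (h1 : χ (-1) = 1) :
    (correlation R R 1 - correlation S S 1) ^ 2 +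
      (correlation R S 1 + correlation S R 1) ^ 2 = (n : ℤ) := by
  have hconj : jacobiSum χ⁻¹ χ⁻¹ = star (jacobiSum χ χ) := by
    simp only [jacobiSum, star_sum, star_mul', MulChar.star_apply']
  have hchar : ringChar ℂ ≠ ringChar (ZMod n) := by
    rw [ringChar.eq_zero, ZMod.ringChar_zmod_n]
    exact (Fact.out : n.Prime).ne_zero.symm
  have h := jacobiSum_mul_jacobiSum_inv hchar hχ hχ hχ2
  rw [hconj, jacobiSum_quartic hRS h1, ZMod.card] at h
  set a := correlation R R 1 - correlation S S 1
  set b := correlation R S 1 + correlation S R 1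
  simp only [star_add, star_mul', Complex.star_def, Complex.conj_I, map_intCast] at h
  have : ((a ^ 2 + b ^ 2 : ℤ) : ℂ) = ((n : ℤ) : ℂ) := by
    push_cast
    rw [← h]
    linear_combination (b ^ 2 : ℂ) * Complex.I_mul_I
  exact_mod_cast this

/-- Modulo 2 every term is 1 except those at x = 0 and x = -1, so the sum is n - 2. -/
theorem odd_correlation_one (hn : Odd n) {P Q : ZMod n → ℤ}
    (hP : ∀ x, (P x : ZMod 2) = if x = 0 then 0 else 1)
    (hQ : ∀ x, (Q x : ZMod 2) = if x = 0 then 0 else 1) : Odd (correlation P Q 1) := by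
  rw [← ZMod.intCast_eq_one_iff_odd, correlation, Int.cast_sum]
  have : ∀ x : ZMod n, ((P x * Q (x + 1) : ℤ) : ZMod 2) =
      1 - (if x = 0 then 1 else 0) - (if x = -1 then 1 else 0) := fun x => by
    simp only [Int.cast_mul, hP, hQ, add_eq_zero_iff_eq_neg]
    by_cases hx : x = 0
    · subst hx; simp
    · by_cases hx' : x = -1 <;> simp [hx, hx']
  simp only [this, Finset.sum_sub_distrib, Finset.sum_ite_eq', Finset.mem_univ, if_true,
    Finset.sum_const, Finset.card_univ, ZMod.card, nsmul_eq_mul, mul_one]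
  rw [(ZMod.natCast_eq_one_iff_odd).2 hn]
  decide

theorem intCast_parity (hsq : ∀ x, R x ^ 2 + S x ^ 2 = if x = 0 then 0 else 1) (x : ZMod n) :
    ((R x + S x : ℤ) : ZMod 2) = (if x = 0 then 0 else 1) ∧
      ((R x - S x : ℤ) : ZMod 2) = if x = 0 then 0 else 1 := by
  have h := congrArg (Int.cast : ℤ → ZMod 2) (hsq x)
  have hid : ∀ a : ZMod 2, a ^ 2 = a := by decide
  push_cast at h ⊢
  rw [hid, hid] at h
  rw [CharTwo.sub_eq_add, h]
  exact ⟨rfl, rfl⟩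

theorem correlation_re_sub_im (hn : Odd n) (hRS : ∀ x, χ x = R x + S x * Complex.I)
    (hsq : ∀ x, R x ^ 2 + S x ^ 2 = if x = 0 then 0 else 1) (hχ : χ ≠ 1)
    (hχ2 : χ * χ ≠ 1) (h1 : χ (-1) = 1) {y : ℤ} (hy : Even y) (hny : (n : ℤ) = 1 + y ^ 2)
    {t : ZMod n} (ht : t ≠ 0) :
    correlation R R t - correlation S S t = 1 ∨ correlation R R t - correlation S S t = -1 := by
  obtain ⟨hR, hS⟩ := even_of_mulChar_eq h1 hRS
  have hodd := odd_correlation_one hn (fun x => (intCast_parity hsq x).1)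
    (fun x => (intCast_parity hsq x).2)
  rw [correlation_add_sub hR hS] at hodd
  have ha := eq_one_or_neg_one_of_sq_add_sq (Nat.prime_iff_prime_int.1 Fact.out) hy hny
    (norm_jacobiSum_quartic hRS hχ hχ2 h1) hodd
  have h := sum_mulChar_mul_shift χ χ ht
  rw [sum_mulChar_mul_mulChar hRS, jacobiSum_quartic hRS h1, ← neg_one_mul, map_mul, h1, one_mul,
    hRS] at h
  have ht2 := hsq t
  rw [if_neg ht] at ht2
  set a := correlation R R 1 - correlation S S 1
  set b := correlation R S 1 + correlation S R 1
  -- `c` and `d` are the real and imaginary parts of χ(t)² (a + bI).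
  have key := (intCast_add_mul_I_inj (c := (R t ^ 2 - S t ^ 2) * a - 2 * (R t * S t) * b)
    (d := (R t ^ 2 - S t ^ 2) * b + 2 * (R t * S t) * a) (h.trans (by
      push_cast
      linear_combination (S t ^ 2 * (a + b * Complex.I) + 2 * R t * S t * b : ℂ) *
        Complex.I_mul_I))).1
  rw [key]
  -- From R(t)² + S(t)² = 1 one coordinate vanishes, so χ(t)² = ±1 and only ±a survives.
  have hr : R t = 0 ∨ S t = 0 := by
    by_contra! hc
    have := sq_pos_of_ne_zero hc.1
    have := sq_pos_of_ne_zero hc.2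
    omega
  rcases hr with hr | hr <;> rw [hr] at ht2 ⊢
  · have : S t ^ 2 = 1 := by linarith
    rw [this]
    rcases ha with ha | ha <;> rw [ha] <;> simp
  · have : R t ^ 2 = 1 := by linarith
    rw [this]
    rcases ha with ha | ha <;> rw [ha] <;> simp

/-- At shift 0 the character sum is Σ χ², zero since χ² is nontrivial. -/
theorem correlation_re_sub_im_zero (hRS : ∀ x, χ x = R x + S x * Complex.I) (hχ2 : χ * χ ≠ 1) :
    correlation R R 0 - correlation S S 0 = 0 := by
  have h := sum_mulChar_mul_mulChar hRS 0
  have h0 : ∑ x, χ x * χ (x + 0) = 0 := by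
    simp only [add_zero, ← MulChar.mul_apply]
    exact MulChar.sum_eq_zero_of_ne_one hχ2
  rw [h0] at h
  refine (intCast_add_mul_I_inj (d := 0) (h.symm.trans ?_)).1
  simp

end Quartic

/-! ### Assembling the sixteen arrangements. -/

theorem isOptimal_of_autoCorr {n : ℕ} (hn : 0 < n) {u : ZMod (2 * n) → ZMod 4}
    (h : ∀ τ : ℕ, 1 ≤ τ → τ < 2 * n → autoCorr u τ = 2 ∨ autoCorr u τ = -2) : IsOptimal u := by
  refine ⟨even_two_mul n, ?_⟩
  have hnorm : ∀ τ : ℕ, 1 ≤ τ → τ < 2 * n → ‖autoCorr u τ‖ = 2 := fun τ h1 h2 => by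
    rcases h τ h1 h2 with h | h <;> simp [h]
  have : {r : ℝ | ∃ τ : ℕ, 1 ≤ τ ∧ τ < 2 * n ∧ r = ‖autoCorr u τ‖} = {2} := by
    ext r
    constructor
    · rintro ⟨τ, h1, h2, rfl⟩
      exact hnorm τ h1 h2
    · rintro rfl
      exact ⟨1, le_rfl, by omega, (hnorm 1 le_rfl (by omega)).symm⟩
  rw [maxAutoCorr, this, csSup_singleton]

/-- Auto-correlations of `quaternary` when the component signs are `δ ± P`, `δ ± Q`, each once,
and the two interleaved pairs each consist of a `P` and a `Q` term. -/
theorem autoCorr_arrangement {n : ℕ} [NeZero n] (hn : Odd n) {s₁ s₃ s₄ s₆ : ZMod n → ZMod 2}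
    {P Q : ZMod n → ℤ} (hP : P.Even) (hQ : Q.Even) (hP0 : P 0 = 0) (hQ0 : Q 0 = 0)
    (h1 : ∀ x, bitSign (s₁ x) = Pi.single (M := fun _ => ℤ) 0 1 x + (-1) * P x)
    (h3 : ∀ x, bitSign (s₃ x) = Pi.single (M := fun _ => ℤ) 0 1 x + (-1) * Q x)
    (h4 : ∀ x, bitSign (s₄ x) = Pi.single (M := fun _ => ℤ) 0 1 x + 1 * Q x)
    (h6 : ∀ x, bitSign (s₆ x) = Pi.single (M := fun _ => ℤ) 0 1 x + 1 * P x)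
    (hsum : ∀ t ≠ 0, correlation P P t + correlation Q Q t = -2)
    (hPQ : ∀ t ≠ 0, correlation P Q t = 1 ∨ correlation P Q t = -1)
    (hPQ0 : correlation P Q 0 = 0)
    (e : Fin 3 → ZMod 2) (he : e 0 + e 1 + e 2 = 0) {a₀ a₁ a₂ a₃ : ZMod n → ZMod 2}
    (ha : (a₀, a₁, a₂, a₃) ∈ arrangements s₁ s₃ s₄ s₆) (τ : ℕ) (hτ : 1 ≤ τ) (hτn : τ < 2 * n) :
    autoCorr (quaternary a₀ a₁ a₂ a₃ e) τ = 2 ∨ autoCorr (quaternary a₀ a₁ a₂ a₃ e) τ = -2 := by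
  have hinj : Function.Injective bitSign := by decide
  have hδ : ∀ x : ZMod n,
      Pi.single (M := fun _ => ℤ) 0 1 (-x) = Pi.single (M := fun _ => ℤ) 0 1 x := fun x => by
    simp only [Pi.single_apply, neg_eq_zero]
  have e1 : s₁.Even := fun x => hinj (by rw [h1, h1, hP, hδ])
  have e3 : s₃.Even := fun x => hinj (by rw [h3, h3, hQ, hδ])
  have e4 : s₄.Even := fun x => hinj (by rw [h4, h4, hQ, hδ])
  have e6 : s₆.Even := fun x => hinj (by rw [h6, h6, hP, hδ])
  have f1 : bitSign ∘ s₁ = fun x => Pi.single (M := fun _ => ℤ) 0 1 x + (-1) * P x := funext h1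
  have f3 : bitSign ∘ s₃ = fun x => Pi.single (M := fun _ => ℤ) 0 1 x + (-1) * Q x := funext h3
  have f4 : bitSign ∘ s₄ = fun x => Pi.single (M := fun _ => ℤ) 0 1 x + 1 * Q x := funext h4
  have f6 : bitSign ∘ s₆ = fun x => Pi.single (M := fun _ => ℤ) 0 1 x + 1 * P x := funext h6
  have hevens : a₀.Even ∧ a₁.Even ∧ a₂.Even ∧ a₃.Even := by
    simp only [arrangements, Set.mem_insert_iff, Set.mem_singleton_iff, Prod.mk.injEq] at ha
    rcases ha with h | h | h | h | h | h | h | h | h | h | h | h | h | h | h | h <;>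
      obtain ⟨rfl, rfl, rfl, rfl⟩ := h <;> exact ⟨‹_›, ‹_›, ‹_›, ‹_›⟩
  -- The linear terms ±2P(t), ±2Q(t) cancel, since each sign occurs once.
  have hauto : ∀ t : ZMod n, t ≠ 0 →
      correlation (bitSign ∘ a₀) (bitSign ∘ a₀) t + correlation (bitSign ∘ a₁) (bitSign ∘ a₁) t +
      correlation (bitSign ∘ a₂) (bitSign ∘ a₂) t + correlation (bitSign ∘ a₃) (bitSign ∘ a₃) t =
      -4 := by
    intro t ht
    have hs := hsum t ht
    have h0 : Pi.single (M := fun _ => ℤ) 0 1 t = 0 := Pi.single_eq_of_ne ht 1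
    have c1 := correlation_single_add (Q := P) hP (-1) (-1) t
    have c6 := correlation_single_add (Q := P) hP 1 1 t
    have c3 := correlation_single_add (Q := Q) hQ (-1) (-1) t
    have c4 := correlation_single_add (Q := Q) hQ 1 1 t
    rw [h0] at c1 c3 c4 c6
    rw [← f1] at c1
    rw [← f3] at c3
    rw [← f4] at c4
    rw [← f6] at c6
    simp only [arrangements, Set.mem_insert_iff, Set.mem_singleton_iff, Prod.mk.injEq] at ha
    rcases ha with h | h | h | h | h | h | h | h | h | h | h | h | h | h | h | h <;>
      obtain ⟨rfl, rfl, rfl, rfl⟩ := h <;> linarith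
  -- In every arrangement the P-signs of the two pairs are opposite, and so are the Q-signs: linear
  -- terms cancel and the coefficients of C(P, Q) agree. The case t = 0 is needed, as t + λ may
  -- vanish for a nonzero odd shift.
  have hcross : ∀ t : ZMod n,
      correlation (bitSign ∘ a₀) (bitSign ∘ a₁) t + correlation (bitSign ∘ a₂) (bitSign ∘ a₃) t =
        2 ∨
      correlation (bitSign ∘ a₀) (bitSign ∘ a₁) t + correlation (bitSign ∘ a₂) (bitSign ∘ a₃) t =
        -2 := by
    intro t
    have c13 := correlation_single_add (Q := Q) hP (-1) (-1) t
    have c14 := correlation_single_add (Q := Q) hP (-1) 1 t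
    have c63 := correlation_single_add (Q := Q) hP 1 (-1) t
    have c64 := correlation_single_add (Q := Q) hP 1 1 t
    have c31 := correlation_single_add (Q := P) hQ (-1) (-1) t
    have c41 := correlation_single_add (Q := P) hQ 1 (-1) t
    have c36 := correlation_single_add (Q := P) hQ (-1) 1 t
    have c46 := correlation_single_add (Q := P) hQ 1 1 t
    rw [← correlation_symm hP hQ] at c31 c41 c36 c46
    rw [← f1] at c13 c14 c31 c41
    rw [← f6] at c63 c64 c36 c46
    rw [← f3] at c13 c63 c31 c36
    rw [← f4] at c14 c64 c41 c46
    have hval : (correlation P Q t = 0 ∧ Pi.single (M := fun _ => ℤ) 0 1 t = 1 ∧ P t = 0 ∧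
        Q t = 0) ∨ (Pi.single (M := fun _ => ℤ) 0 1 t = 0 ∧
          (correlation P Q t = 1 ∨ correlation P Q t = -1)) := by
      by_cases ht : t = 0
      · subst ht; exact Or.inl ⟨hPQ0, Pi.single_eq_same 0 1, hP0, hQ0⟩
      · exact Or.inr ⟨Pi.single_eq_of_ne ht 1, hPQ t ht⟩
    simp only [arrangements, Set.mem_insert_iff, Set.mem_singleton_iff, Prod.mk.injEq] at ha
    rcases hval with ⟨hc, hd, hp, hq⟩ | ⟨hd, hc | hc⟩
    · simp only [hd, hc, hp, hq] at c13 c14 c63 c64 c31 c41 c36 c46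
      left
      rcases ha with h | h | h | h | h | h | h | h | h | h | h | h | h | h | h | h <;>
        obtain ⟨rfl, rfl, rfl, rfl⟩ := h <;> 
        simp only [c13, c14, c63, c64, c31, c41, c36, c46] <;> norm_num
    · simp only [hd, hc] at c13 c14 c63 c64 c31 c41 c36 c46
      rcases ha with h | h | h | h | h | h | h | h | h | h | h | h | h | h | h | h <;>
        obtain ⟨rfl, rfl, rfl, rfl⟩ := h <;>
        simp only [c13, c14, c63, c64, c31, c41, c36, c46] <;>
        first | (left; ring1) | (right; ring1)
    · simp only [hd, hc] at c13 c14 c63 c64 c31 c41 c36 c46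
      rcases ha with h | h | h | h | h | h | h | h | h | h | h | h | h | h | h | h <;>
        obtain ⟨rfl, rfl, rfl, rfl⟩ := h <;>
        simp only [c13, c14, c63, c64, c31, c41, c36, c46] <;>
        first | (left; ring1) | (right; ring1)
  obtain ⟨g0, g1, g2, g3⟩ := hevens
  rcases Nat.even_or_odd' τ with ⟨t, rfl | rfl⟩
  · right
    have ht : (t : ZMod n) ≠ 0 := fun h => by
      have := Nat.le_of_dvd (by omega) ((ZMod.natCast_eq_zero_iff t n).1 h)
      omega
    rw [autoCorr_quaternary_two_mul a₀ a₁ a₂ a₃ e g0 g1 g2 g3, hauto t ht]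
    norm_num
  · rw [autoCorr_quaternary_two_mul_add_one a₀ a₁ a₂ a₃ e hn g0 g1 g2 g3 he]
    rcases bitSign_eq (e 0) with hb | hb <;>
      rcases hcross (t + ((n + 1) / 2 : ℕ)) with hc | hc <;> rw [hb, hc] <;> norm_num

end QuaternarySeq

theorem theorem10 (n f : ℕ) (x y : ℤ) (hn : n.Prime) (hnf : n = 4 * f + 1)
    (hxy : (n : ℤ) = x ^ 2 + 4 * y ^ 2) (hf : Even f) (hx : x = 1 ∨ x = -1)
    (α : (ZMod n)ˣ) (hα : ∀ β : (ZMod n)ˣ, β ∈ Subgroup.zpowers α)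
    (e : Fin 3 → ZMod 2) (he : e 0 + e 1 + e 2 = 0)
    (a₀ a₁ a₂ a₃ : ZMod n → ZMod 2)
    (ha : (a₀, a₁, a₂, a₃) ∈ QuaternarySeq.arrangements
      (QuaternarySeq.s₁ f α) (QuaternarySeq.s₃ f α)
      (QuaternarySeq.s₄ f α) (QuaternarySeq.s₆ f α)) :
    QuaternarySeq.IsOptimal (QuaternarySeq.quaternary a₀ a₁ a₂ a₃ e) ∧
      ∀ τ : ℕ, 1 ≤ τ → τ < 2 * n →
        QuaternarySeq.autoCorr (QuaternarySeq.quaternary a₀ a₁ a₂ a₃ e) τ = 2 ∨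
        QuaternarySeq.autoCorr (QuaternarySeq.quaternary a₀ a₁ a₂ a₃ e) τ = -2 := by
  open QuaternarySeq in
  have : Fact n.Prime := ⟨hn⟩
  have hodd : Odd n := ⟨2 * f, by omega⟩
  obtain ⟨χ, hχα⟩ := exists_quartic_mulChar hnf α hα
  obtain ⟨R, S, hRS, hsq, hsign⟩ := exists_sign_functions hnf α hα hχα
  have hneg := quartic_neg_one hnf hf α hα hχα
  obtain ⟨hR, hS⟩ := even_of_mulChar_eq hneg hRS
  have hχ : χ ≠ 1 := fun h => by
    rw [h, MulChar.one_apply_coe] at hχα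
    simpa using congrArg Complex.re hχα
  have hχ2 : χ * χ ≠ 1 := fun h => by
    have h' := congrArg (fun ψ : MulChar (ZMod n) ℂ => ψ α) h
    simp only [MulChar.mul_apply, hχα, MulChar.one_apply_coe, Complex.I_mul_I] at h'
    norm_num at h'
  have hny : (n : ℤ) = 1 + (2 * y) ^ 2 := by
    rcases hx with rfl | rfl <;> linarith
  have h00 : R 0 = 0 ∧ S 0 = 0 := by
    apply intCast_add_mul_I_inj
    rw [← hRS, MulChar.map_zero]
    simp
  have main := autoCorr_arrangement (P := fun x => R x + S x) (Q := fun x => R x - S x) hodd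
    (fun x => by simp only [hR x, hS x]) (fun x => by simp only [hR x, hS x])
    (by simp only [h00, add_zero]) (by simp only [h00, sub_zero])
    (fun x => (hsign x).1) (fun x => (hsign x).2.1) (fun x => (hsign x).2.2.1)
    (fun x => (hsign x).2.2.2)
    (fun t ht => by
      rw [correlation_add_sub_self, correlation_re_add_im hRS hχ hneg ht]; norm_num)
    (fun t ht => by
      rw [correlation_add_sub hR hS]
      exact correlation_re_sub_im hodd hRS hsq hχ hχ2 hneg (even_two_mul y) hny ht)
    (by rw [correlation_add_sub hR hS, correlation_re_sub_im_zero hRS hχ2])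
    e he ha
  exact ⟨isOptimal_of_autoCorr hn.pos main, main⟩
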